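/- Let $(X,d)$ be a compact geodesic metric space (any two points $x,y$ are joined by an isometrically embedded interval $[0,d(x,y)]$) with a basepoint $\bullet\in X$. For $r>0$ let $\operatorname{Rips}(X,r)$ be the open Rips complex: the simplicial complex with vertex set $X$ whose simplices are the nonempty finite subsets of diameter less than $r$. For $0<p<q$ let $i_{p,q}\colon \pi_1(\operatorname{Rips}(X,p),\bullet)\to\pi_1(\operatorname{Rips}(X,q),\bullet)$ be the homomorphism induced by the inclusion. Call $p>0$ a *left critical value* if for all small enough $\varepsilon>0$ the map $i_{p-\varepsilon,p}$ is not an isomorphism, a *right critical value* if for all $\varepsilon>0$ the map $i_{p,p+\varepsilon}$ is not an isomorphism, and a *critical value* if it is either of these. Then every critical value is a right critical value. Moreover, there are no left critical values; in other words, no bonding map fails to be an isomorphism from the left: for every $p>0$ there is $\varepsilon_0>0$ such that $i_{q,p}$ is an isomorphism for all $q>0$ with $p-\varepsilon_0<q<p$. -/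

import Mathlib

open CategoryTheory

universe u v w

/-! ### Geodesic spaces -/

/-- A metric space is geodesic if any two points `x`, `y` are joined by an isometric copy of the
interval `[0, dist x y]`. -/
def IsGeodesicSpace (X : Type u) [MetricSpace X] : Prop :=
  ∀ x y : X, ∃ γ : ℝ → X, γ 0 = x ∧ γ (dist x y) = y ∧
    ∀ s ∈ Set.Icc 0 (dist x y), ∀ t ∈ Set.Icc 0 (dist x y), dist (γ s) (γ t) = |s - t|

/-! ### Geometric realization of an abstract simplicial complex -/

/-- A point of the geometric realization: a finitely supported family of barycentric coordinates,
nonnegative, with sum `1`, whose support is a simplex of `K`. -/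
@[ext]
structure GeomRealization {V : Type u} (K : AbstractSimplicialComplex V) where
  weight : V →₀ ℝ
  nonneg : ∀ v, 0 ≤ weight v
  sum_eq_one : (weight.sum fun _ a => a) = 1
  support_mem : weight.support ∈ K.faces

namespace GeomRealization

variable {V : Type u}

/-- The closed simplex `|σ|` inside the realization. -/
def closedSimplex (K : AbstractSimplicialComplex V) (σ : Finset V) :
    Set (GeomRealization K) :=
  {p | p.weight.support ⊆ σ}

/-- The Euclidean topology of a closed simplex, given by the barycentric coordinates. -/
abbrev simplexTopology (K : AbstractSimplicialComplex V) (σ : Finset V) :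
    TopologicalSpace (closedSimplex K σ) :=
  TopologicalSpace.induced (fun p => (p.1.weight : V → ℝ)) Pi.topologicalSpace

/-- The weak (coherent) topology: a set is open iff its intersection with every closed simplex of
`K` is open in the Euclidean topology of that simplex. -/
instance (K : AbstractSimplicialComplex V) : TopologicalSpace (GeomRealization K) :=
  ⨆ σ : K.faces, TopologicalSpace.coinduced
    (Subtype.val : closedSimplex K σ.1 → GeomRealization K) (simplexTopology K σ.1)

/-- The vertex `v`, as a point of the realization. -/
noncomputable def vertex (K : AbstractSimplicialComplex V) (v : V) : GeomRealization K where
  weight := Finsupp.single v 1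
  nonneg x := by
    classical
    rw [Finsupp.single_apply]
    split_ifs <;> norm_num
  sum_eq_one := by simp
  support_mem := by
    rw [Finsupp.support_single v one_ne_zero]
    exact K.singleton_mem v

/-- The map of realizations given by the inclusion of a subcomplex; it is the identity on
vertices. -/
def inclusionFun {K L : AbstractSimplicialComplex V} (h : K.faces ⊆ L.faces)
    (p : GeomRealization K) : GeomRealization L where
  weight := p.weight
  nonneg := p.nonneg
  sum_eq_one := p.sum_eq_one
  support_mem := h p.support_mem

theorem continuous_inclusionFun {K L : AbstractSimplicialComplex V} (h : K.faces ⊆ L.faces) :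
    Continuous (inclusionFun h) := by
  refine continuous_iSup_dom.2 fun σ => ?_
  refine continuous_coinduced_dom.2 ?_
  let _ := simplexTopology K σ.1
  let _ := simplexTopology L σ.1
  have h1 : Continuous (Subtype.val : closedSimplex L σ.1 → GeomRealization L) :=
    continuous_iff_coinduced_le.2 (le_iSup (fun τ : L.faces => TopologicalSpace.coinduced
      (Subtype.val : closedSimplex L τ.1 → GeomRealization L) (simplexTopology L τ.1))
      ⟨σ.1, h σ.2⟩)
  have h2 : Continuous (fun p : closedSimplex K σ.1 =>
      (⟨inclusionFun h p.1, p.2⟩ : closedSimplex L σ.1)) :=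
    continuous_induced_rng.2 continuous_induced_dom
  exact h1.comp h2

/-- `inclusionFun` as a bundled continuous map. -/
def inclusion {K L : AbstractSimplicialComplex V} (h : K.faces ⊆ L.faces) :
    C(GeomRealization K, GeomRealization L) :=
  ⟨inclusionFun h, continuous_inclusionFun h⟩

end GeomRealization

/-! ### The open Rips filtration and its fundamental groups -/

/-- The open Rips complex of `X` at scale `r > 0`: its simplices are the nonempty finite subsets
of `X` of diameter less than `r`. -/
def openRips (X : Type u) [MetricSpace X] (r : Set.Ioi (0 : ℝ)) : AbstractSimplicialComplex X where
  faces := {σ | σ.Nonempty ∧ Metric.diam (σ : Set X) < r}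
  isRelLowerSet_faces := by
    intro σ hσ
    refine ⟨hσ.1, fun τ hτσ hτ => ⟨hτ, ?_⟩⟩
    exact (Metric.diam_mono (Finset.coe_subset.2 hτσ) σ.finite_toSet.isBounded).trans_lt hσ.2
  singleton_mem x := by
    refine ⟨Finset.singleton_nonempty x, ?_⟩
    rw [Finset.coe_singleton, Metric.diam_singleton]
    exact r.2

theorem openRips_mono (X : Type u) [MetricSpace X] {p q : Set.Ioi (0 : ℝ)} (h : p ≤ q) :
    (openRips X p).faces ⊆ (openRips X q).faces :=
  fun _ hσ => ⟨hσ.1, hσ.2.trans_le h⟩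

/-- The `π₁`-persistence of `(X, x₀)` via the open Rips filtration: the groups
`π₁(Rips(X, r), x₀)`, `r > 0`, with the homomorphisms induced by the inclusions. -/
noncomputable def openRipsPiOne (X : Type u) [MetricSpace X] (x₀ : X) :
    Set.Ioi (0 : ℝ) ⥤ GrpCat.{u} where
  obj r := GrpCat.of
    (FundamentalGroup (GeomRealization (openRips X r)) (GeomRealization.vertex (openRips X r) x₀))
  map {p q} f := GrpCat.ofHom
    (FundamentalGroup.map (GeomRealization.inclusion (openRips_mono X (leOfHom f)))
      (GeomRealization.vertex (openRips X p) x₀))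
  map_id r := by
    ext γ
    induction γ using Path.Homotopic.Quotient.ind with
    | mk γ => rfl
  map_comp f g := by
    ext γ
    induction γ using Path.Homotopic.Quotient.ind with
    | mk γ => rfl

/-! ### Critical values of a filtration -/

/-- `p` is a left critical value of the filtration `C`: for all small enough `ε > 0` the bonding
map from `p - ε` to `p` is not an isomorphism. -/
def IsLeftCriticalValue {𝒞 : Type v} [Category.{w} 𝒞] (C : Set.Ioi (0 : ℝ) ⥤ 𝒞)
    (p : Set.Ioi (0 : ℝ)) : Prop :=
  ∃ ε₀ : ℝ, 0 < ε₀ ∧ ∀ (q : Set.Ioi (0 : ℝ)) (h : q < p), (p : ℝ) - ε₀ < q →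
    ¬ IsIso (C.map (homOfLE h.le))

/-- `p` is a right critical value of the filtration `C`: for all `ε > 0` the bonding map from `p`
to `p + ε` is not an isomorphism. -/
def IsRightCriticalValue {𝒞 : Type v} [Category.{w} 𝒞] (C : Set.Ioi (0 : ℝ) ⥤ 𝒞)
    (p : Set.Ioi (0 : ℝ)) : Prop :=
  ∀ (q : Set.Ioi (0 : ℝ)) (h : p < q), ¬ IsIso (C.map (homOfLE h.le))

/-- A critical value is a left critical value or a right critical value. -/
def IsCriticalValue {𝒞 : Type v} [Category.{w} 𝒞] (C : Set.Ioi (0 : ℝ) ⥤ 𝒞)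
    (p : Set.Ioi (0 : ℝ)) : Prop :=
  IsLeftCriticalValue C p ∨ IsRightCriticalValue C p

/-! ### Path classes inside simply connected subsets -/

/-! For `q` slightly below `p` the bonding map is shown to be bijective; then left critical values
cannot occur and every critical value is a right one.

Surjectivity only needs `q > 2p/3`. Cutting a path into pieces lying in open stars shows that every
path class between vertices is a product of edges (`isEdgePath`). A point `b` two thirds along a
geodesic replaces an edge of length less than `p` by two edges shorter than `q`, and the three edges
bound a simplex at scale `p` (`IsGeodesicSpace.exists_map_eq`).

Injectivity uses cocycles instead of null-homotopies. A `G`-valued cocycle defines a covering with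
fibre `G`, whose monodromy evaluates the cocycle along edge paths (`IsCocycle.exists_monodromy`).
Let `G` be the fundamental group at scale `q`: edges closed up by chosen paths from the basepoint
form a tautological `G`-valued cocycle. If it extends to scale `p`, the monodromy of the extension
recovers a class at scale `q`, up to conjugation, from its image at scale `p`, so the kernel is
trivial (`IsGeodesicSpace.eq_one_of_map_eq_one`).

The extension gives an edge the product of the values along its trisection
(`IsGeodesicSpace.eventually_exists_extension`). To check the cocycle identity on a triple of
diameter less than `p`, displace it slightly to one of diameter less than `q`, where the identity is
known; the values on the displacements cancel. Compactness makes one `q` serve all triples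
(`eventually_exists_triple_near`). -/

namespace IsSimplyConnected

variable {Y : Type u} [TopologicalSpace Y] {S T R : Set Y} {a b c : Y}

/-- The homotopy class of the paths from `a` to `b` inside a simply connected set. -/
noncomputable def hom (hS : IsSimplyConnected S) (ha : a ∈ S) (hb : b ∈ S) :
    FundamentalGroupoid.mk a ⟶ FundamentalGroupoid.mk b :=
  have := hS.simplyConnectedSpace
  Path.Homotopic.Quotient.mk
    ((PathConnectedSpace.somePath (⟨a, ha⟩ : S) ⟨b, hb⟩).map continuous_subtype_val)

/-- Paths in `S` with common ends are homotopic in `S`, hence in `Y`, so the path chosen in `hom` is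
immaterial. -/
theorem mk_eq_hom (hS : IsSimplyConnected S) (ha : a ∈ S) (hb : b ∈ S) (γ : Path a b)
    (h : ∀ t, γ t ∈ S) : Path.Homotopic.Quotient.mk γ = hS.hom ha hb := by
  have := hS.simplyConnectedSpace
  let γ' : Path (⟨a, ha⟩ : S) ⟨b, hb⟩ :=
    { toFun := fun t => ⟨γ t, h t⟩
      continuous_toFun := by fun_prop
      source' := Subtype.ext γ.source
      target' := Subtype.ext γ.target }
  have key := (SimplyConnectedSpace.paths_homotopic γ'
    (PathConnectedSpace.somePath (⟨a, ha⟩ : S) ⟨b, hb⟩)).map ⟨Subtype.val, continuous_subtype_val⟩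
  exact Quotient.sound key

theorem exists_mk_eq_hom (hS : IsSimplyConnected S) (ha : a ∈ S) (hb : b ∈ S) :
    ∃ γ : Path a b, (∀ t, γ t ∈ S) ∧ Path.Homotopic.Quotient.mk γ = hS.hom ha hb :=
  have := hS.simplyConnectedSpace
  ⟨(PathConnectedSpace.somePath (⟨a, ha⟩ : S) ⟨b, hb⟩).map continuous_subtype_val,
    fun t => (PathConnectedSpace.somePath (⟨a, ha⟩ : S) ⟨b, hb⟩ t).2, rfl⟩

theorem hom_mono (hS : IsSimplyConnected S) (hT : IsSimplyConnected T) (h : S ⊆ T) (ha : a ∈ S)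
    (hb : b ∈ S) : hS.hom ha hb = hT.hom (h ha) (h hb) := by
  obtain ⟨γ, hγ, h1⟩ := hS.exists_mk_eq_hom ha hb
  rw [← h1, hT.mk_eq_hom (h ha) (h hb) γ fun t => h (hγ t)]

theorem hom_self (hS : IsSimplyConnected S) (ha : a ∈ S) :
    hS.hom ha ha = 𝟙 (FundamentalGroupoid.mk a) :=
  (hS.mk_eq_hom ha ha (Path.refl a) fun _ => ha).symm

theorem hom_comp (hS : IsSimplyConnected S) (ha : a ∈ S) (hb : b ∈ S) (hc : c ∈ S) :
    hS.hom ha hb ≫ hS.hom hb hc = hS.hom ha hc := by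
  obtain ⟨γ, hγ, h1⟩ := hS.exists_mk_eq_hom ha hb
  obtain ⟨γ', hγ', h2⟩ := hS.exists_mk_eq_hom hb hc
  rw [← hS.mk_eq_hom ha hc (γ.trans γ'), ← h1, ← h2]
  · rfl
  · intro t
    have : γ.trans γ' t ∈ Set.range (γ.trans γ') := ⟨t, rfl⟩
    rw [Path.trans_range] at this
    rcases this with ⟨s, hs⟩ | ⟨s, hs⟩
    · exact hs ▸ hγ s
    · exact hs ▸ hγ' s

theorem map_hom {Z : Type v} [TopologicalSpace Z] {T : Set Z} (hS : IsSimplyConnected S)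
    (hT : IsSimplyConnected T) (f : C(Y, Z)) (h : Set.MapsTo f S T) (ha : a ∈ S) (hb : b ∈ S) :
    (FundamentalGroupoid.map f).map (hS.hom ha hb) = hT.hom (h ha) (h hb) := by
  obtain ⟨γ, hγ, h1⟩ := hS.exists_mk_eq_hom ha hb
  rw [← h1]
  exact hT.mk_eq_hom (h ha) (h hb) (γ.map f.continuous) fun t => h (hγ t)

end IsSimplyConnected

/-! ### Simplices and open stars in the realization -/

namespace GeomRealization

variable {V : Type u} {K : AbstractSimplicialComplex V} {σ : Finset V}

theorem face_of_subset {τ : Finset V} (hσ : σ ∈ K.faces) (h : τ ⊆ σ) (hτ : τ.Nonempty) :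
    τ ∈ K.faces :=
  (K.isRelLowerSet_faces hσ).2 h hτ

/-- The standard simplex with vertex set `σ`, as a set of functions on `V`. -/
def coordSimplex (σ : Finset V) : Set (V → ℝ) :=
  {f | (∀ v, 0 ≤ f v) ∧ (∀ v ∉ σ, f v = 0) ∧ ∑ v ∈ σ, f v = 1}

theorem convex_coordSimplex (σ : Finset V) : Convex ℝ (coordSimplex σ) := by
  rintro f ⟨hf0, hf1, hf2⟩ g ⟨hg0, hg1, hg2⟩ a b ha hb hab
  refine ⟨fun v => ?_, fun v hv => ?_, ?_⟩
  · have := hf0 v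
    have := hg0 v
    simp only [Pi.add_apply, Pi.smul_apply, smul_eq_mul]
    positivity
  · simp [hf1 v hv, hg1 v hv]
  · simp [Finset.sum_add_distrib, ← Finset.mul_sum, hf2, hg2, hab]

/-- The point of the realization with given barycentric coordinates in a face. -/
noncomputable def ofCoords (hσ : σ ∈ K.faces) (f : coordSimplex σ) : GeomRealization K where
  weight := Finsupp.onFinset σ f.1 fun v hv => by
    by_contra h
    exact hv (f.2.2.1 v h)
  nonneg := f.2.1
  sum_eq_one := by
    rw [Finsupp.onFinset_sum _ (fun _ => rfl)]
    exact f.2.2.2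
  support_mem := by
    refine face_of_subset hσ Finsupp.support_onFinset_subset ?_
    rw [Finset.nonempty_iff_ne_empty]
    intro h
    have h0 : ∀ v, f.1 v = 0 := fun v => by
      have := Finsupp.notMem_support_iff.1 (h ▸ Finset.notMem_empty v)
      simpa using this
    have := f.2.2.2
    simp [h0] at this

theorem weight_mem_coordSimplex (p : GeomRealization K) (h : p.weight.support ⊆ σ) :
    (p.weight : V → ℝ) ∈ coordSimplex σ := by
  refine ⟨p.nonneg, fun v hv => Finsupp.notMem_support_iff.1 fun h' => hv (h h'), ?_⟩
  rw [← p.sum_eq_one]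
  exact (Finset.sum_subset h fun v _ hv => Finsupp.notMem_support_iff.1 hv).symm

theorem ofCoords_mem (hσ : σ ∈ K.faces) (f : coordSimplex σ) : ofCoords hσ f ∈ closedSimplex K σ := by
  intro v hv
  by_contra h
  exact Finsupp.mem_support_iff.1 hv (f.2.2.1 v h)

theorem ofCoords_weight_eq (hσ : σ ∈ K.faces) (p : GeomRealization K)
    (h : p.weight.support ⊆ σ) : ofCoords hσ ⟨p.weight, weight_mem_coordSimplex p h⟩ = p := by
  ext v
  rfl

/-- Barycentric coordinates identify each closed simplex, with its induced topology, with
`coordSimplex σ`; the coherence condition is transported along this identification. -/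
theorem isOpen_iff {U : Set (GeomRealization K)} :
    IsOpen U ↔ ∀ σ (hσ : σ ∈ K.faces), IsOpen (ofCoords hσ ⁻¹' U) := by
  have h1 : IsOpen U ↔ ∀ σ : K.faces, @IsOpen _ (simplexTopology K σ.1)
      ((Subtype.val : closedSimplex K σ.1 → GeomRealization K) ⁻¹' U) := by
    change @IsOpen _ (⨆ σ : K.faces, TopologicalSpace.coinduced
      (Subtype.val : closedSimplex K σ.1 → GeomRealization K) (simplexTopology K σ.1)) U ↔ _
    rw [isOpen_iSup_iff]
    exact forall_congr' fun σ => isOpen_coinduced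
  rw [h1]
  constructor
  · rintro h σ hσ
    obtain ⟨t, ht, hU⟩ := isOpen_induced_iff.1 (h ⟨σ, hσ⟩)
    refine isOpen_induced_iff.2 ⟨t, ht, ?_⟩
    ext f
    exact Set.ext_iff.1 hU ⟨ofCoords hσ f, ofCoords_mem hσ f⟩
  · rintro h ⟨σ, hσ⟩
    obtain ⟨t, ht, hU⟩ := isOpen_induced_iff.1 (h σ hσ)
    refine isOpen_induced_iff.2 ⟨t, ht, ?_⟩
    ext p
    have := Set.ext_iff.1 hU ⟨p.1.weight, weight_mem_coordSimplex p.1 p.2⟩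
    rw [Set.mem_preimage, Set.mem_preimage, ofCoords_weight_eq hσ p.1 p.2] at this
    exact this

theorem continuous_ofCoords (hσ : σ ∈ K.faces) : Continuous (ofCoords hσ) :=
  continuous_def.2 fun _ hU => isOpen_iff.1 hU σ hσ

/-- Continuity on an open subset of the realization can be checked on faces. -/
theorem continuous_of_isOpen {Y : Type v} [TopologicalSpace Y] {U : Set (GeomRealization K)}
    (hU : IsOpen U) (f : U → Y)
    (h : ∀ σ (hσ : σ ∈ K.faces),
      Continuous fun x : {x : coordSimplex σ // ofCoords hσ x ∈ U} => f ⟨ofCoords hσ x, x.2⟩) :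
    Continuous f := by
  refine continuous_def.2 fun O hO => ?_
  rw [hU.isOpenEmbedding_subtypeVal.isOpen_iff_image_isOpen, isOpen_iff]
  intro σ hσ
  have hW : IsOpen {x : coordSimplex σ | ofCoords hσ x ∈ U} := isOpen_iff.1 hU σ hσ
  have h1 := hO.preimage (h σ hσ)
  rw [hW.isOpenEmbedding_subtypeVal.isOpen_iff_image_isOpen] at h1
  convert h1 using 1
  ext x
  simp

theorem continuous_weight (v : V) : Continuous fun p : GeomRealization K => p.weight v := by
  refine continuous_def.2 fun O hO => isOpen_iff.2 fun σ hσ => ?_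
  exact hO.preimage ((continuous_apply v).comp continuous_subtype_val)

/-- A closed simplex is homeomorphic to a standard simplex. -/
noncomputable def closedSimplexHomeomorph (hσ : σ ∈ K.faces) :
    closedSimplex K σ ≃ₜ coordSimplex σ where
  toFun p := ⟨p.1.weight, weight_mem_coordSimplex p.1 p.2⟩
  invFun f := ⟨ofCoords hσ f, ofCoords_mem hσ f⟩
  left_inv p := Subtype.ext (ofCoords_weight_eq hσ p.1 p.2)
  right_inv _ := rfl
  continuous_toFun := Continuous.subtype_mk
    (continuous_pi fun v => (continuous_weight v).comp continuous_subtype_val) _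
  continuous_invFun := (continuous_ofCoords hσ).subtype_mk _

theorem vertex_mem_closedSimplex {v : V} (hv : v ∈ σ) : vertex K v ∈ closedSimplex K σ := by
  change (Finsupp.single v (1 : ℝ)).support ⊆ σ
  rw [Finsupp.support_single v one_ne_zero]
  simpa using hv

theorem isSimplyConnected_closedSimplex (hσ : σ ∈ K.faces) :
    IsSimplyConnected (closedSimplex K σ) := by
  obtain ⟨v, hv⟩ := (K.isRelLowerSet_faces hσ).1
  have hne : (coordSimplex σ).Nonempty :=
    ⟨_, weight_mem_coordSimplex (vertex K v) (vertex_mem_closedSimplex hv)⟩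
  have := (convex_coordSimplex σ).contractibleSpace hne
  have := (closedSimplexHomeomorph hσ).contractibleSpace
  exact inferInstanceAs (SimplyConnectedSpace (closedSimplex K σ))

/-- The open star of a vertex. -/
def openStar (K : AbstractSimplicialComplex V) (v : V) : Set (GeomRealization K) :=
  {p | v ∈ p.weight.support}

theorem mem_openStar_iff {v : V} {p : GeomRealization K} : p ∈ openStar K v ↔ 0 < p.weight v := by
  rw [openStar, Set.mem_ofPred_eq, Finsupp.mem_support_iff]
  exact (p.nonneg v).lt_iff_ne'.symm

theorem isOpen_openStar (v : V) : IsOpen (openStar K v) := by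
  have : openStar K v = (fun p : GeomRealization K => p.weight v) ⁻¹' Set.Ioi 0 := by
    ext p
    exact mem_openStar_iff
  rw [this]
  exact isOpen_Ioi.preimage (continuous_weight v)

theorem mem_openStar_vertex_iff {v w : V} : vertex K w ∈ openStar K v ↔ v = w := by
  change v ∈ (Finsupp.single w (1 : ℝ)).support ↔ _
  rw [Finsupp.support_single w one_ne_zero, Finset.mem_singleton]

theorem vertex_mem_openStar (v : V) : vertex K v ∈ openStar K v :=
  mem_openStar_vertex_iff.2 rfl

open unitInterval in
/-- The point at time `t` on the segment from `p` to a vertex `v` of the carrier of `p`. -/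
noncomputable def contractStar {v : V} (p : openStar K v) (t : I) : GeomRealization K where
  weight := (σ t : ℝ) • p.1.weight + (t : ℝ) • Finsupp.single v 1
  nonneg w := by
    have h1 := p.1.nonneg w
    have h2 := (vertex K v).nonneg w
    exact add_nonneg (mul_nonneg (σ t).2.1 h1) (mul_nonneg t.2.1 h2)
  sum_eq_one := by
    have h1 := p.1.sum_eq_one
    rw [Finsupp.sum_add_index' (by simp) (by simp), Finsupp.sum_smul_index' (by simp),
      Finsupp.sum_smul_index' (by simp)]
    simp only [smul_eq_mul, ← Finsupp.mul_sum, h1]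
    simp
  support_mem := by
    classical
    refine face_of_subset p.1.support_mem ?_ ?_
    · refine Finsupp.support_add.trans (Finset.union_subset Finsupp.support_smul ?_)
      refine (Finsupp.support_smul.trans Finsupp.support_single_subset).trans ?_
      exact Finset.singleton_subset_iff.2 p.2
    · refine ⟨v, Finsupp.mem_support_iff.2 ?_⟩
      have hv : 0 < p.1.weight v := mem_openStar_iff.1 p.2
      have h1 := t.2.1
      have h2 := t.2.2
      simp only [Finsupp.add_apply, Finsupp.smul_apply, smul_eq_mul, Finsupp.single_eq_same,
        coe_symm_eq]
      rcases h1.eq_or_lt with h | h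
      · rw [← h]; simpa using hv.ne'
      · have : 0 ≤ (1 - (t : ℝ)) * p.1.weight v := mul_nonneg (by linarith) hv.le
        linarith

open unitInterval in
theorem contractStar_weight {v : V} (p : openStar K v) (t : I) (w : V) :
    (contractStar p t).weight w = (1 - (t : ℝ)) * p.1.weight w + t * (vertex K v).weight w := rfl

theorem contractStar_mem {v : V} (p : openStar K v) (t : unitInterval) :
    contractStar p t ∈ openStar K v := by
  rw [mem_openStar_iff, contractStar_weight]
  have hv : 0 < p.1.weight v := mem_openStar_iff.1 p.2
  have h1 := t.2.1
  have h2 := t.2.2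
  have h3 : (vertex K v).weight v = 1 := Finsupp.single_eq_same
  rw [h3]
  rcases h1.eq_or_lt with h | h
  · rw [← h]; simpa using hv
  · have : 0 ≤ (1 - (t : ℝ)) * p.1.weight v := mul_nonneg (by linarith) hv.le
    linarith

theorem support_contractStar_subset {v : V} (p : openStar K v) (t : unitInterval) :
    (contractStar p t).weight.support ⊆ p.1.weight.support := by
  intro w hw
  by_contra h
  have hne : v ≠ w := fun e => h (e ▸ p.2)
  have h3 : (vertex K v).weight w = 0 := Finsupp.single_eq_of_ne' hne
  refine Finsupp.mem_support_iff.1 hw ?_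
  rw [contractStar_weight, Finsupp.notMem_support_iff.1 h, h3]
  ring

theorem continuous_contractStar_comp {v : V} {A : Type w} [TopologicalSpace A]
    (hσ : σ ∈ K.faces) (f : A → openStar K v) (hf : ∀ a, (f a).1.weight.support ⊆ σ)
    (hc : ∀ w, Continuous fun a => (f a).1.weight w) :
    Continuous fun x : A × unitInterval => contractStar (f x.1) x.2 := by
  have h1 : ∀ x : A × unitInterval, (contractStar (f x.1) x.2).weight.support ⊆ σ :=
    fun x => (support_contractStar_subset _ _).trans (hf x.1)
  have h2 : Continuous fun x : A × unitInterval =>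
      (⟨_, weight_mem_coordSimplex _ (h1 x)⟩ : coordSimplex σ) := by
    refine Continuous.subtype_mk (continuous_pi fun w => ?_) _
    simp only [contractStar_weight]
    have := (hc w).comp (continuous_fst (X := A) (Y := unitInterval))
    exact ((continuous_const.sub (continuous_subtype_val.comp continuous_snd)).mul this).add
      ((continuous_subtype_val.comp continuous_snd).mul continuous_const)
  refine ((continuous_ofCoords hσ).comp h2).congr fun x => ?_
  exact ofCoords_weight_eq hσ _ (h1 x)

/-- Coherence with the faces is known for open subsets of the realization, not for their products
with the interval. Currying moves the time variable into the target, and local compactness of the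
interval allows uncurrying afterwards. -/
theorem continuous_contractStar (v : V) :
    Continuous fun x : openStar K v × unitInterval => contractStar x.1 x.2 := by
  have hpt : ∀ p : openStar K v, Continuous (contractStar p) := fun p => by
    have h := continuous_contractStar_comp p.1.support_mem (fun _ : Unit => p)
      (fun _ => Finset.Subset.refl _) fun _ => continuous_const
    exact h.comp (f := fun t : unitInterval => ((), t)) (by fun_prop)
  let F : openStar K v → C(unitInterval, GeomRealization K) := fun p => ⟨contractStar p, hpt p⟩
  have hF : Continuous F := by
    refine continuous_of_isOpen (isOpen_openStar v) F fun σ hσ => ?_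
    refine ContinuousMap.continuous_of_continuous_uncurry _ ?_
    exact continuous_contractStar_comp hσ
      (fun x : {x : coordSimplex σ // ofCoords hσ x ∈ openStar K v} => ⟨ofCoords hσ x, x.2⟩)
      (fun x => ofCoords_mem hσ x.1)
      fun w => (continuous_apply w).comp (continuous_subtype_val.comp continuous_subtype_val)
  exact ContinuousMap.continuous_uncurry_of_continuous ⟨F, hF⟩

theorem isSimplyConnected_openStar (v : V) : IsSimplyConnected (openStar K v) := by
  have : ContractibleSpace (openStar K v) := by
    rw [contractible_iff_id_nullhomotopic]
    let H : C(unitInterval × openStar K v, openStar K v) :=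
      ⟨fun x => ⟨contractStar x.2 x.1, contractStar_mem x.2 x.1⟩,
        ((continuous_contractStar v).comp continuous_swap).subtype_mk _⟩
    have h0 : ∀ p, H (0, p) = p := fun p => by
      refine Subtype.ext (GeomRealization.ext (Finsupp.ext fun w => ?_))
      refine (contractStar_weight p 0 w).trans ?_
      simp
    have h1 : ∀ p, H (1, p) = ⟨vertex K v, vertex_mem_openStar v⟩ := fun p => by
      refine Subtype.ext (GeomRealization.ext (Finsupp.ext fun w => ?_))
      refine (contractStar_weight p 1 w).trans ?_
      simp
    exact ⟨_, ⟨⟨H, h0, h1⟩⟩⟩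
  exact inferInstanceAs (SimplyConnectedSpace (openStar K v))

end GeomRealization

/-! ### Edge paths -/

namespace GeomRealization

variable {V : Type u} {K : AbstractSimplicialComplex V}

/-- The vertex `v` as an object of the fundamental groupoid of the realization. -/
noncomputable abbrev vertexObj (K : AbstractSimplicialComplex V) (v : V) :
    FundamentalGroupoid (GeomRealization K) :=
  FundamentalGroupoid.mk (vertex K v)

/-- The homotopy class of the edge path between two vertices of a face. -/
noncomputable def edgeHom {σ : Finset V} (hσ : σ ∈ K.faces) {v w : V} (hv : v ∈ σ) (hw : w ∈ σ) :
    vertexObj K v ⟶ vertexObj K w :=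
  (isSimplyConnected_closedSimplex hσ).hom (vertex_mem_closedSimplex hv)
    (vertex_mem_closedSimplex hw)

theorem edgeHom_comp {σ : Finset V} (hσ : σ ∈ K.faces) {v w z : V} (hv : v ∈ σ) (hw : w ∈ σ)
    (hz : z ∈ σ) : edgeHom hσ hv hw ≫ edgeHom hσ hw hz = edgeHom hσ hv hz :=
  IsSimplyConnected.hom_comp _ _ _ _

theorem edgeHom_mono {σ τ : Finset V} (hσ : σ ∈ K.faces) (hτ : τ ∈ K.faces) (h : σ ⊆ τ) {v w : V}
    (hv : v ∈ σ) (hw : w ∈ σ) : edgeHom hσ hv hw = edgeHom hτ (h hv) (h hw) :=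
  IsSimplyConnected.hom_mono _ _ (fun _ hp => subset_trans hp h) _ _

theorem map_edgeHom {L : AbstractSimplicialComplex V} (h : K.faces ⊆ L.faces) {σ : Finset V}
    (hσ : σ ∈ K.faces) {v w : V} (hv : v ∈ σ) (hw : w ∈ σ) :
    (FundamentalGroupoid.map (inclusion h)).map (edgeHom hσ hv hw) = edgeHom (h hσ) hv hw :=
  IsSimplyConnected.map_hom _ (isSimplyConnected_closedSimplex (h hσ)) (inclusion h)
    (fun _ hp => hp) _ _

/-- The path classes between vertices that are products of edges. -/
inductive IsEdgePath (K : AbstractSimplicialComplex V) (v : V) :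
    ∀ w : V, (vertexObj K v ⟶ vertexObj K w) → Prop
  | nil : IsEdgePath K v v (𝟙 _)
  | snoc {w z : V} {f : vertexObj K v ⟶ vertexObj K w} (hf : IsEdgePath K v w f) {σ : Finset V}
      (hσ : σ ∈ K.faces) (hw : w ∈ σ) (hz : z ∈ σ) : IsEdgePath K v z (f ≫ edgeHom hσ hw hz)

/-- The class of the radial path from a vertex to a point of its open star. -/
noncomputable def radial {v : V} {a : GeomRealization K} (ha : a ∈ openStar K v) :
    vertexObj K v ⟶ FundamentalGroupoid.mk a :=
  (isSimplyConnected_openStar v).hom (vertex_mem_openStar v) ha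

/-- The segment from a carrier vertex `u` to `a` lies both in the open star of `u` and in the
carrier simplex of `a`, so every radial class can be computed in that one simplex. -/
theorem radial_eq {v w : V} {a : GeomRealization K} (hv : a ∈ openStar K v)
    (hw : a ∈ openStar K w) : radial hv = edgeHom a.support_mem hv hw ≫ radial hw := by
  have hS := isSimplyConnected_closedSimplex a.support_mem
  have ha : a ∈ closedSimplex K a.weight.support := Finset.Subset.refl _
  have key : ∀ {u : V} (hu : a ∈ openStar K u),
      radial hu = hS.hom (vertex_mem_closedSimplex hu) ha := by
    intro u hu
    let γ : Path (vertex K u) a :=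
      { toFun := fun t => contractStar ⟨a, hu⟩ (unitInterval.symm t)
        continuous_toFun := (continuous_contractStar u).comp
          (f := fun t : unitInterval => ((⟨a, hu⟩ : openStar K u), unitInterval.symm t))
          (by fun_prop)
        source' := by
          refine GeomRealization.ext (Finsupp.ext fun w => ?_)
          rw [contractStar_weight]
          simp
        target' := by
          refine GeomRealization.ext (Finsupp.ext fun w => ?_)
          rw [contractStar_weight]
          simp }
    rw [radial, ← IsSimplyConnected.mk_eq_hom _ _ _ γ fun t => contractStar_mem _ _]
    exact IsSimplyConnected.mk_eq_hom _ _ _ γ fun t => support_contractStar_subset _ _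
  rw [key hv, key hw]
  exact (hS.hom_comp _ _ _).symm

theorem radial_comp {v : V} {a b : GeomRealization K} (ha : a ∈ openStar K v)
    (hb : b ∈ openStar K v) (γ : Path a b) (h : ∀ t, γ t ∈ openStar K v) :
    radial ha ≫ FundamentalGroupoid.fromPath (Path.Homotopic.Quotient.mk γ) = radial hb := by
  have h1 := (isSimplyConnected_openStar v).mk_eq_hom ha hb γ h
  rw [FundamentalGroupoid.fromPath, h1, radial, radial, IsSimplyConnected.hom_comp]

/-- Subdivide `γ` so that each piece stays in one open star. There it is absorbed by radial classes,
and changing stars at a cut point costs one edge by `radial_eq`. -/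
theorem exists_isEdgePath_aux (γ : C(unitInterval, GeomRealization K)) {v w : V}
    (hv : γ 0 ∈ openStar K v) (hw : γ 1 ∈ openStar K w) :
    ∃ f, IsEdgePath K v w f ∧
      radial hv ≫ FundamentalGroupoid.fromPath
        (Path.Homotopic.Quotient.mk (⟨γ, rfl, rfl⟩ : Path (γ 0) (γ 1))) = f ≫ radial hw := by
  obtain ⟨t, ht0, htm, ⟨n, hn⟩, ht⟩ := exists_monotone_Icc_subset_open_cover_unitInterval
    (c := fun v => γ ⁻¹' openStar K v) (fun v => (isOpen_openStar v).preimage γ.continuous)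
    (fun s _ => by
      obtain ⟨u, hu⟩ := (K.isRelLowerSet_faces (γ s).support_mem).1
      exact Set.mem_iUnion.2 ⟨u, hu⟩)
  let P : Path (γ 0) (γ 1) := ⟨γ, rfl, rfl⟩
  have key : ∀ (n : ℕ) (h0 : γ (t 0) ∈ openStar K v) (u : V) (hu : γ (t n) ∈ openStar K u),
      ∃ f, IsEdgePath K v u f ∧ radial h0 ≫ FundamentalGroupoid.fromPath
        (Path.Homotopic.Quotient.mk (P.subpath (t 0) (t n))) = f ≫ radial hu := by
    intro n
    induction n with
    | zero =>
      intro h0 u hu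
      refine ⟨𝟙 _ ≫ edgeHom (γ (t 0)).support_mem h0 hu, .snoc .nil _ _ _, ?_⟩
      rw [Path.subpath_self, Category.id_comp, ← radial_eq h0 hu]
      exact Category.comp_id _
    | succ n ih =>
      intro h0 u hu
      obtain ⟨i, hi⟩ := ht n
      have hle : t n ≤ t (n + 1) := htm n.le_succ
      have hin : γ (t n) ∈ openStar K i := hi ⟨le_rfl, hle⟩
      have hin' : γ (t (n + 1)) ∈ openStar K i := hi ⟨hle, le_rfl⟩
      obtain ⟨f, hf, hfe⟩ := ih h0 i hin
      refine ⟨f ≫ edgeHom (γ (t (n + 1))).support_mem hin' hu, .snoc hf _ _ _, ?_⟩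
      have hsub : Path.Homotopic.Quotient.mk (P.subpath (t 0) (t (n + 1))) =
          (Path.Homotopic.Quotient.mk (P.subpath (t 0) (t n))).trans
            (Path.Homotopic.Quotient.mk (P.subpath (t n) (t (n + 1)))) :=
        (Path.Homotopic.Quotient.eq.2 ⟨Path.Homotopy.subpathTransSubpath P _ _ _⟩).symm
      have hstep := radial_comp hin hin' (P.subpath (t n) (t (n + 1))) fun s => by
        have : P.subpath (t n) (t (n + 1)) s ∈ Set.range (P.subpath (t n) (t (n + 1))) := ⟨s, rfl⟩
        rw [Path.range_subpath_of_le _ _ _ hle] at this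
        obtain ⟨r, hr, hrs⟩ := this
        exact hrs ▸ hi hr
      rw [hsub, Category.assoc, ← radial_eq hin' hu, ← hstep, ← Category.assoc, ← hfe,
        Category.assoc]
      rfl
  -- The end parameters equal `0` and `1` only propositionally, and the types depend on them; they
  -- are generalized so that they can be substituted.
  have key' : ∀ (s s' : unitInterval), s = 0 → s' = 1 →
      (∀ (h0 : γ s ∈ openStar K v) (u : V) (hu : γ s' ∈ openStar K u),
        ∃ f, IsEdgePath K v u f ∧ radial h0 ≫ FundamentalGroupoid.fromPath
          (Path.Homotopic.Quotient.mk (P.subpath s s')) = f ≫ radial hu) →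
      ∃ f, IsEdgePath K v w f ∧ radial hv ≫ FundamentalGroupoid.fromPath
        (Path.Homotopic.Quotient.mk P) = f ≫ radial hw := by
    rintro s s' rfl rfl h
    obtain ⟨f, hf, hfe⟩ := h hv w hw
    refine ⟨f, hf, ?_⟩
    rw [Path.subpath_zero_one] at hfe
    exact hfe
  exact key' _ _ ht0 (hn n le_rfl) (key n)

theorem radial_vertex {v : V} (h : vertex K v ∈ openStar K v) : radial h = 𝟙 (vertexObj K v) :=
  IsSimplyConnected.hom_self _ _

/-- Every path class between vertices is a product of edges. -/
theorem isEdgePath {v w : V} (f : vertexObj K v ⟶ vertexObj K w) : IsEdgePath K v w f := by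
  have key : ∀ (a b : GeomRealization K) (γ : Path a b) (ha : a ∈ openStar K v)
      (hb : b ∈ openStar K w), ∃ f, IsEdgePath K v w f ∧
        radial ha ≫ FundamentalGroupoid.fromPath (Path.Homotopic.Quotient.mk γ) =
          f ≫ radial hb := by
    rintro a b ⟨γ, rfl, rfl⟩ ha hb
    exact exists_isEdgePath_aux γ ha hb
  obtain ⟨γ, rfl⟩ := Path.Homotopic.Quotient.mk_surjective f
  obtain ⟨f, hf, hfe⟩ := key _ _ γ (vertex_mem_openStar v) (vertex_mem_openStar w)
  rw [radial_vertex, radial_vertex, Category.comp_id] at hfe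
  erw [Category.id_comp] at hfe
  have hfe' : Path.Homotopic.Quotient.mk γ = f := hfe
  exact hfe'.symm ▸ hf

end GeomRealization

/-! ### Coverings and monodromy of cocycles -/

namespace GeomRealization

variable {V : Type u} {L : AbstractSimplicialComplex V} {G : Type v} [Group G]

/-- A group-valued 1-cocycle on a simplicial complex. -/
def IsCocycle (L : AbstractSimplicialComplex V) (φ : V → V → G) : Prop :=
  ∀ σ ∈ L.faces, ∀ u ∈ σ, ∀ v ∈ σ, ∀ w ∈ σ, φ v w * φ u v = φ u w

theorem IsCocycle.self {φ : V → V → G} (hφ : IsCocycle L φ) (v : V) : φ v v = 1 := by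
  have h := Finset.mem_singleton_self v
  exact mul_eq_left.1 (hφ {v} (L.singleton_mem v) v h v h v h)

/-- A vertex of the carrier of a point. -/
noncomputable def someVertex (p : GeomRealization L) : V :=
  (L.isRelLowerSet_faces p.support_mem).1.choose

theorem mem_openStar_someVertex (p : GeomRealization L) : p ∈ openStar L (someVertex p) :=
  (L.isRelLowerSet_faces p.support_mem).1.choose_spec

theorem someVertex_vertex (v : V) : someVertex (vertex L v) = v :=
  mem_openStar_vertex_iff.1 (mem_openStar_someVertex (vertex L v))

/-- The principal bundle with discrete fibre `G` determined by a cocycle. -/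
noncomputable def cocycleBundle [TopologicalSpace G] [DiscreteTopology G] {φ : V → V → G}
    (hφ : IsCocycle L φ) : FiberBundleCore V (GeomRealization L) G where
  baseSet := openStar L
  isOpen_baseSet := isOpen_openStar
  indexAt := someVertex
  mem_baseSet_at := mem_openStar_someVertex
  coordChange v w _ g := φ v w * g
  coordChange_self v p _ g := by rw [hφ.self, one_mul]
  continuousOn_coordChange v w := by fun_prop
  coordChange_comp u v w p hp g := by
    rw [← mul_assoc, hφ _ p.support_mem u hp.1.1 v hp.1.2 w hp.2]

/-- The monodromy of a cocycle: path classes between vertices act on the group, an edge acting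
by multiplication by the value of the cocycle. -/
theorem IsCocycle.exists_monodromy {φ : V → V → G} (hφ : IsCocycle L φ) :
    ∃ M : ∀ v w : V, (vertexObj L v ⟶ vertexObj L w) → G → G,
      (∀ v g, M v v (𝟙 _) g = g) ∧
      (∀ u v w (f : vertexObj L u ⟶ vertexObj L v) (f' : vertexObj L v ⟶ vertexObj L w) g,
        M u w (f ≫ f') g = M v w f' (M u v f g)) ∧
      ∀ (σ : Finset V) (hσ : σ ∈ L.faces) (v w : V) (hv : v ∈ σ) (hw : w ∈ σ) (g : G),
        M v w (edgeHom hσ hv hw) g = φ v w * g := by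
  let _ : TopologicalSpace G := ⊥
  have : DiscreteTopology G := ⟨rfl⟩
  let Z := cocycleBundle hφ
  have cov : IsCoveringMap Z.proj := FiberBundle.isCoveringMap (F := G) (E := Z.Fiber)
  let pt : ∀ (v : V) (g : G), Z.proj ⁻¹' {vertex L v} := fun v g => ⟨⟨vertex L v, g⟩, rfl⟩
  let co : ∀ v : V, Z.proj ⁻¹' {vertex L v} → G := fun v e => e.1.2
  have hpt : ∀ (v : V) (e : Z.proj ⁻¹' {vertex L v}), pt v (co v e) = e := by
    rintro v ⟨⟨b, g⟩, h⟩
    have h' : b = vertex L v := h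
    subst h'
    rfl
  refine ⟨fun v w f g => co w (cov.monodromy f (pt v g)), fun v g => ?_,
    fun u v w f f' g => ?_, fun σ hσ v w hv hw g => ?_⟩
  · exact congrArg (co v) (congrFun cov.monodromy_refl (pt v g))
  · dsimp only
    rw [hpt]
    exact congrArg (co w) (cov.monodromy_trans_apply f f' (pt u g))
  -- A section over the closed simplex through the point `φ v v * g` above `v`. It lifts any path
  -- inside the simplex, so the monodromy of an edge can be read off at its end.
  · let s : closedSimplex L σ → Z.TotalSpace := fun p => ⟨p.1, φ v (someVertex p.1) * g⟩
    have hs : Continuous s := by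
      refine continuous_iff_continuousAt.2 fun p => ?_
      let i := someVertex p.1
      let N : Set (closedSimplex L σ) := {q | q.1 ∈ openStar L i}
      have hN : IsOpen N := (isOpen_openStar i).preimage continuous_subtype_val
      have hp : p ∈ N := mem_openStar_someVertex p.1
      have h1 : ContinuousOn (Z.localTriv i).toOpenPartialHomeomorph.symm
          (Z.localTriv i).toOpenPartialHomeomorph.target :=
        (Z.localTriv i).toOpenPartialHomeomorph.continuousOn_symm
      -- In the chart of `i` the section has the constant coordinate `φ v i * g`, by the cocycle
      -- identity on `σ`.
      have h2 : ContinuousOn (fun q : closedSimplex L σ =>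
          (Z.localTriv i).toOpenPartialHomeomorph.symm (q.1, φ v i * g)) N := by
        refine h1.comp (by fun_prop) fun q hq => ?_
        exact (Z.mem_localTriv_target i (q.1, φ v i * g)).2 hq
      refine (h2.congr fun q hq => ?_).continuousAt (hN.mem_nhds hp)
      have hi : i ∈ σ := q.2 hq
      have hq' : someVertex q.1 ∈ σ := q.2 (mem_openStar_someVertex q.1)
      have : φ v (someVertex q.1) * g = φ i (someVertex q.1) * (φ v i * g) := by
        rw [← mul_assoc, hφ σ hσ v hv i hi _ hq']
      exact congrArg (fun x : G => (⟨q.1, x⟩ : Z.TotalSpace)) this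
    have hsv : ∀ u (hu : u ∈ σ), s ⟨vertex L u, vertex_mem_closedSimplex hu⟩ =
        (pt u (φ v u * g)).1 := fun u hu => by
      change (⟨vertex L u, φ v (someVertex (vertex L u)) * g⟩ : Z.TotalSpace) = _
      rw [someVertex_vertex]
    obtain ⟨γ, hγ, hγe⟩ := (isSimplyConnected_closedSimplex hσ).exists_mk_eq_hom
      (vertex_mem_closedSimplex hv) (vertex_mem_closedSimplex hw)
    let Γ : Path (pt v (φ v v * g)).1 (pt w (φ v w * g)).1 :=
      { toFun := fun t => s ⟨γ t, hγ t⟩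
        continuous_toFun := hs.comp (by fun_prop)
        source' := by
          rw [← hsv v hv]
          exact congrArg s (Subtype.ext γ.source)
        target' := by
          rw [← hsv w hw]
          exact congrArg s (Subtype.ext γ.target) }
    have h := cov.monodromy_map (Path.Homotopic.Quotient.mk Γ)
    have h2 : (Path.Homotopic.Quotient.mk Γ).map ⟨Z.proj, cov.continuous⟩ =
        Path.Homotopic.Quotient.mk γ := rfl
    have h3 : cov.monodromy (Path.Homotopic.Quotient.mk γ) (pt v (φ v v * g)) =
        pt w (φ v w * g) := h
    rw [hφ.self, one_mul] at h3
    rw [edgeHom, ← hγe]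
    exact congrArg (co w) h3

end GeomRealization

/-! ### Cocycles on a geodesic space -/

open Filter Topology

/-- Thirds rather than halves: for geodesics with nearby ends, going through the ends bounds the
distance of the midpoints only by about the full length, but that of the points `b` by about two
thirds of it. -/
theorem IsGeodesicSpace.exists_thirds {X : Type u} [MetricSpace X] (hX : IsGeodesicSpace X)
    (x y : X) : ∃ a b : X, dist x a = dist x y / 3 ∧ dist a b = dist x y / 3 ∧
      dist b y = dist x y / 3 := by
  obtain ⟨γ, h0, h1, h⟩ := hX x y
  have hd : 0 ≤ dist x y := dist_nonneg
  have m0 : (0 : ℝ) ∈ Set.Icc 0 (dist x y) := ⟨le_rfl, hd⟩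
  have m1 : dist x y / 3 ∈ Set.Icc 0 (dist x y) := ⟨by linarith, by linarith⟩
  have m2 : 2 * dist x y / 3 ∈ Set.Icc 0 (dist x y) := ⟨by linarith, by linarith⟩
  have m3 : dist x y ∈ Set.Icc 0 (dist x y) := ⟨hd, le_rfl⟩
  have e1 := h _ m0 _ m1
  have e2 := h _ m1 _ m2
  have e3 := h _ m2 _ m3
  rw [h0, abs_of_nonpos (by linarith)] at e1
  rw [abs_of_nonpos (by linarith)] at e2
  rw [h1, abs_of_nonpos (by linarith)] at e3
  exact ⟨γ (dist x y / 3), γ (2 * dist x y / 3), by linarith, by linarith, by linarith⟩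

/-- In a compact space, the triples of diameter less than `p` are approximated by triples of
diameter less than `q`, for all `q < p` close enough to `p`. -/
theorem eventually_exists_triple_near {X : Type u} [MetricSpace X] [CompactSpace X] (p : ℝ)
    {δ : ℝ} (hδ : 0 < δ) :
    ∀ᶠ q in 𝓝[<] p, ∀ x y z : X, dist x y < p → dist y z < p → dist x z < p →
      ∃ x' y' z' : X, dist x x' < δ ∧ dist y y' < δ ∧ dist z z' < δ ∧
        dist x' y' < q ∧ dist y' z' < q ∧ dist x' z' < q := by
  obtain ⟨t, -, ht, hcov⟩ := Metric.finite_approx_of_totallyBounded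
    (isCompact_univ (X := X)).totallyBounded (δ / 2) (half_pos hδ)
  have : Finite t := ht
  have hn : ∀ x : X, ∃ a : t, dist x a < δ / 2 := fun x => by
    simpa using hcov (Set.mem_univ x)
  choose n hn using hn
  have near : ∀ x y : X, n x = n y → dist x y < δ := fun x y h => by
    have h1 := hn x
    have h2 := hn y
    rw [← h, dist_comm] at h2
    linarith [dist_triangle x (n x) y]
  -- The fibres of `n` are finitely many cells of small diameter. For each occupied triple of cells
  -- one representative suffices, and its three distances stay below `q` for `q` near `p`.
  have key : ∀ᶠ q in 𝓝[<] p, ∀ τ : t × t × t,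
      (∃ x y z : X, (n x, n y, n z) = τ ∧ dist x y < p ∧ dist y z < p ∧ dist x z < p) →
      ∃ x y z : X, (n x, n y, n z) = τ ∧ dist x y < q ∧ dist y z < q ∧ dist x z < q := by
    refine eventually_all.2 fun τ => ?_
    by_cases h : ∃ x y z : X, (n x, n y, n z) = τ ∧ dist x y < p ∧ dist y z < p ∧ dist x z < p
    · obtain ⟨x, y, z, hτ, h1, h2, h3⟩ := h
      filter_upwards [Ioo_mem_nhdsLT h1, Ioo_mem_nhdsLT h2, Ioo_mem_nhdsLT h3]
        with q hq1 hq2 hq3 _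
      exact ⟨x, y, z, hτ, hq1.1, hq2.1, hq3.1⟩
    · exact Eventually.of_forall fun q h' => absurd h' h
  filter_upwards [key] with q hq x y z h1 h2 h3
  obtain ⟨x', y', z', hτ, h1', h2', h3'⟩ := hq _ ⟨x, y, z, rfl, h1, h2, h3⟩
  simp only [Prod.mk.injEq] at hτ
  exact ⟨x', y', z', near _ _ hτ.1.symm, near _ _ hτ.2.1.symm, near _ _ hτ.2.2.symm,
    h1', h2', h3'⟩

/-- A group-valued function of pairs of points satisfying the cocycle identity on all triples of
diameter less than `r`. -/
def IsRipsCocycle {X : Type u} [MetricSpace X] {G : Type v} [Group G] (r : ℝ)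
    (g : X → X → G) : Prop :=
  ∀ x y z : X, dist x y < r → dist y z < r → dist x z < r → g y z * g x y = g x z

/-- On a compact geodesic space, for `q < p` close enough to `p`, every cocycle at scale `q` extends
to a cocycle at scale `p`. -/
theorem IsGeodesicSpace.eventually_exists_extension {X : Type u} [MetricSpace X] [CompactSpace X]
    (hX : IsGeodesicSpace X) {p : ℝ} (hp : 0 < p) :
    ∀ᶠ q in 𝓝[<] p, ∀ (G : Type u) [Group G] (g : X → X → G), IsRipsCocycle q g →
      ∃ φ : X → X → G, IsRipsCocycle p φ ∧ ∀ x y, dist x y < q → φ x y = g x y := by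
  have h34 : 3 * p / 4 < p := by linarith
  -- The longest distances needed below are at most `2p/3 + p/12 = 3p/4`, hence less than `q`.
  filter_upwards [eventually_exists_triple_near (X := X) p (δ := p / 12) (by positivity),
    Ioo_mem_nhdsLT h34] with q hq hqp G _ g hg
  choose a b hxa hab hby using hX.exists_thirds
  have hxb : ∀ x y, dist x (b x y) ≤ 2 * dist x y / 3 := fun x y => by
    linarith [dist_triangle x (a x y) (b x y), hxa x y, hab x y]
  have hq1 := hqp.1
  have hq2 := hqp.2
  -- The first two thirds span a triple at scale `q`, so `a` drops out and only `b` matters.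
  have hg1 : ∀ x y, dist x y < p → g (a x y) (b x y) * g x (a x y) = g x (b x y) := by
    intro x y h
    have := hxa x y
    have := hab x y
    have := hxb x y
    exact hg _ _ _ (by linarith) (by linarith) (by linarith)
  have ext : ∀ x y, dist x y < q →
      g (b x y) y * (g (a x y) (b x y) * g x (a x y)) = g x y := by
    intro x y h
    have e1 := hxb x y
    have e3 := hby x y
    rw [hg1 x y (by linarith), hg _ _ _ (by linarith) (by linarith) h]
  refine ⟨fun x y => g (b x y) y * (g (a x y) (b x y) * g x (a x y)), ?_, ext⟩
  -- With `b`, `b'` the division points of the two edges, the triples `(b, y, y')`, `(x, x', b')`,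
  -- `(x, b, b')` and `(b, b', y')` fill the quadrilateral between the edges at scale `q`.
  have move : ∀ x y x' y', dist x y < p → dist x' y' < p → dist x x' < p / 12 →
      dist y y' < p / 12 →
      g y y' * (g (b x y) y * (g (a x y) (b x y) * g x (a x y))) =
        g (b x' y') y' * (g (a x' y') (b x' y') * g x' (a x' y')) * g x x' := by
    intro x y x' y' h h' hx hy
    rw [hg1 x y h, hg1 x' y' h']
    have e1 := hxb x y
    have e2 := hxb x' y'
    have e3 := hby x y
    have e4 := hby x' y'
    have d1 : dist (b x y) y' ≤ dist (b x y) y + dist y y' := dist_triangle _ _ _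
    have d2 : dist x (b x' y') ≤ dist x x' + dist x' (b x' y') := dist_triangle _ _ _
    have d3 : dist (b x y) (b x' y') ≤ dist (b x y) y' + dist y' (b x' y') :=
      dist_triangle _ _ _
    rw [dist_comm y'] at d3
    rw [← mul_assoc, hg (b x y) y y' (by linarith) (by linarith) (by linarith), mul_assoc,
      hg x x' (b x' y') (by linarith) (by linarith) (by linarith),
      ← hg x (b x y) (b x' y') (by linarith) (by linarith) (by linarith),
      ← hg (b x y) (b x' y') y' (by linarith) (by linarith) (by linarith), mul_assoc]
  intro x y z hxy hyz hxz
  obtain ⟨x', y', z', hx, hy, hz, hxy', hyz', hxz'⟩ := hq x y z hxy hyz hxz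
  have m1 := move x y x' y' hxy (by linarith) hx hy
  have m2 := move y z y' z' hyz (by linarith) hy hz
  have m3 := move x z x' z' hxz (by linarith) hx hz
  rw [ext _ _ hxy'] at m1
  rw [ext _ _ hyz'] at m2
  rw [ext _ _ hxz'] at m3
  dsimp only
  -- After multiplication by `g z z'`, the relations `m1`, `m2`, `m3` reduce the identity to that of
  -- `g` on `x'`, `y'`, `z'`.
  refine mul_left_cancel (a := g z z') ?_
  rw [m3, ← mul_assoc (g z z'), m2, mul_assoc (g y' z'), m1, ← mul_assoc,
    hg _ _ _ hxy' hyz' hxz']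

/-! ### The fundamental groups of the Rips complexes -/

open GeomRealization

section Rips

variable {X : Type u} [MetricSpace X]

/-- The strict bound passes to the diameter because a finite set attains its largest distance. -/
theorem mem_openRips_of_dist {r : Set.Ioi (0 : ℝ)} {σ : Finset X} (hne : σ.Nonempty)
    (h : ∀ x ∈ σ, ∀ y ∈ σ, dist x y < r) : σ ∈ (openRips X r).faces := by
  refine ⟨hne, ?_⟩
  obtain ⟨z, hz, hmax⟩ := (σ ×ˢ σ).exists_max_image (fun z => dist z.1 z.2) (hne.product hne)
  rw [Finset.mem_product] at hz
  refine (Metric.diam_le_of_forall_dist_le dist_nonneg fun x hx y hy => ?_).trans_lt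
    (h _ hz.1 _ hz.2)
  exact hmax (x, y) (Finset.mem_product.2 ⟨hx, hy⟩)

theorem dist_lt_of_mem_openRips {r : Set.Ioi (0 : ℝ)} {σ : Finset X}
    (hσ : σ ∈ (openRips X r).faces) {x y : X} (hx : x ∈ σ) (hy : y ∈ σ) : dist x y < r :=
  (Metric.dist_le_diam_of_mem σ.finite_toSet.isBounded hx hy).trans_lt hσ.2

open Classical in
theorem pair_mem_openRips {r : Set.Ioi (0 : ℝ)} {x y : X} (h : dist x y < r) :
    ({x, y} : Finset X) ∈ (openRips X r).faces := by
  have hr : (0 : ℝ) < r := r.2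
  refine mem_openRips_of_dist (Finset.insert_nonempty _ _) ?_
  simp [h, dist_comm y x, hr]

open Classical in
theorem triple_mem_openRips {r : Set.Ioi (0 : ℝ)} {x y z : X} (hxy : dist x y < r)
    (hyz : dist y z < r) (hxz : dist x z < r) :
    ({x, y, z} : Finset X) ∈ (openRips X r).faces := by
  have hr : (0 : ℝ) < r := r.2
  refine mem_openRips_of_dist (Finset.insert_nonempty _ _) ?_
  simp [hxy, hyz, hxz, dist_comm y x, dist_comm z x, dist_comm z y, hr]

open Classical in
/-- The edge joining two points at distance less than `r`. -/
noncomputable def ripsEdge {r : Set.Ioi (0 : ℝ)} {x y : X} (h : dist x y < r) :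
    vertexObj (openRips X r) x ⟶ vertexObj (openRips X r) y :=
  edgeHom (pair_mem_openRips h) (Finset.mem_insert_self _ _)
    (Finset.mem_insert_of_mem (Finset.mem_singleton_self _))

theorem edgeHom_eq_ripsEdge {r : Set.Ioi (0 : ℝ)} {σ : Finset X} (hσ : σ ∈ (openRips X r).faces)
    {x y : X} (hx : x ∈ σ) (hy : y ∈ σ) :
    edgeHom hσ hx hy = ripsEdge (dist_lt_of_mem_openRips hσ hx hy) := by
  classical
  refine (edgeHom_mono _ hσ ?_ _ _).symm
  simp [Finset.insert_subset_iff, hx, hy]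

theorem ripsEdge_comp {r : Set.Ioi (0 : ℝ)} {x y z : X} (hxy : dist x y < r)
    (hyz : dist y z < r) (hxz : dist x z < r) :
    ripsEdge hxy ≫ ripsEdge hyz = ripsEdge hxz := by
  classical
  have h := triple_mem_openRips hxy hyz hxz
  have hx : x ∈ ({x, y, z} : Finset X) := by simp
  have hy : y ∈ ({x, y, z} : Finset X) := by simp
  have hz : z ∈ ({x, y, z} : Finset X) := by simp
  have := edgeHom_comp h hx hy hz
  simpa only [edgeHom_eq_ripsEdge] using this

theorem map_ripsEdge {p q : Set.Ioi (0 : ℝ)} (h : p ≤ q) {x y : X} (hxy : dist x y < p) :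
    (FundamentalGroupoid.map (inclusion (openRips_mono X h))).map (ripsEdge hxy) =
      ripsEdge (hxy.trans_le h) :=
  map_edgeHom (openRips_mono X h) _ _ _

/-- On a geodesic space every path class in the realization of a Rips complex comes from a Rips
complex at any smaller scale. -/
theorem IsGeodesicSpace.exists_map_eq (hX : IsGeodesicSpace X) {p q : Set.Ioi (0 : ℝ)} (h : q ≤ p)
    (hpq : (2 / 3 : ℝ) * p < q) {v w : X}
    (f : vertexObj (openRips X p) v ⟶ vertexObj (openRips X p) w) :
    ∃ f' : vertexObj (openRips X q) v ⟶ vertexObj (openRips X q) w,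
      (FundamentalGroupoid.map (inclusion (openRips_mono X h))).map f' = f := by
  induction isEdgePath f with
  | nil => exact ⟨𝟙 _, CategoryTheory.Functor.map_id _ _⟩
  | @snoc w z f hf σ hσ hw hz ih =>
    obtain ⟨f', rfl⟩ := ih
    rw [edgeHom_eq_ripsEdge]
    have hd := dist_lt_of_mem_openRips hσ hw hz
    obtain ⟨a, b, h1, h2, h3⟩ := hX.exists_thirds w z
    have hd0 : 0 ≤ dist w z := dist_nonneg
    have hwb := dist_triangle w a b
    have e1 : dist w b < q := by linarith
    have e2 : dist b z < q := by linarith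
    refine ⟨f' ≫ ripsEdge e1 ≫ ripsEdge e2, ?_⟩
    rw [Functor.map_comp, Functor.map_comp, map_ripsEdge h, map_ripsEdge h]
    congr 1
    exact ripsEdge_comp _ _ hd

/-- A geodesic space has connected Rips complexes. -/
theorem IsGeodesicSpace.nonempty_hom (hX : IsGeodesicSpace X) (r : Set.Ioi (0 : ℝ)) (x y : X) :
    Nonempty (vertexObj (openRips X r) x ⟶ vertexObj (openRips X r) y) := by
  have hr : (0 : ℝ) < r := r.2
  -- Cutting at `b` leaves pieces of at most two thirds of the distance, whence the base `3/2`.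
  have key : ∀ (n : ℕ) (x y : X), dist x y < (3 / 2 : ℝ) ^ n * r →
      Nonempty (vertexObj (openRips X r) x ⟶ vertexObj (openRips X r) y) := by
    intro n
    induction n with
    | zero =>
      intro x y h
      rw [pow_zero, one_mul] at h
      exact ⟨ripsEdge h⟩
    | succ n ih =>
      intro x y h
      obtain ⟨a, b, h1, h2, h3⟩ := hX.exists_thirds x y
      have hd0 : 0 ≤ dist x y := dist_nonneg
      have hwb := dist_triangle x a b
      rw [pow_succ] at h
      obtain ⟨f⟩ := ih x b (by linarith)
      obtain ⟨g⟩ := ih b y (by linarith)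
      exact ⟨f ≫ g⟩
  obtain ⟨n, hn⟩ := pow_unbounded_of_one_lt (dist x y / r) (by norm_num : (1 : ℝ) < 3 / 2)
  exact key n x y ((div_lt_iff₀ hr).1 hn)

/-- If every cocycle on the smaller Rips complex extends to the larger one, then the inclusion is
injective on fundamental groups. -/
theorem IsGeodesicSpace.eq_one_of_map_eq_one (hX : IsGeodesicSpace X) {p q : Set.Ioi (0 : ℝ)}
    (h : q ≤ p) (hext : ∀ (G : Type u) [Group G] (g : X → X → G), IsRipsCocycle (q : ℝ) g →
      ∃ φ : X → X → G, IsRipsCocycle (p : ℝ) φ ∧ ∀ x y, dist x y < q → φ x y = g x y) (x₀ : X)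
    (f : vertexObj (openRips X q) x₀ ⟶ vertexObj (openRips X q) x₀)
    (hf : (FundamentalGroupoid.map (inclusion (openRips_mono X h))).map f =
      𝟙 (vertexObj (openRips X p) x₀)) : f = 𝟙 _ := by
  -- Arbitrary paths closing edges up to loops; `c x₀` need not be trivial, so classes are recovered
  -- only up to conjugation.
  have c : ∀ v, vertexObj (openRips X q) x₀ ⟶ vertexObj (openRips X q) v :=
    fun v => (hX.nonempty_hom q x₀ v).some
  let G := FundamentalGroup (GeomRealization (openRips X q)) (vertex (openRips X q) x₀)
  let conj : ∀ v w : X, (vertexObj (openRips X q) v ⟶ vertexObj (openRips X q) w) → G :=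
    fun v w f => c v ≫ f ≫ Groupoid.inv (c w)
  have conj_comp : ∀ (u v w : X) (f : vertexObj (openRips X q) u ⟶ vertexObj (openRips X q) v)
      (f' : vertexObj (openRips X q) v ⟶ vertexObj (openRips X q) w),
      conj u w (f ≫ f') = conj v w f' * conj u v f := by
    intro u v w f f'
    -- Multiplication in `G` is composition in the opposite order, which explains the order of
    -- factors in the cocycle identity.
    change _ = (c u ≫ f ≫ Groupoid.inv (c v)) ≫ (c v ≫ f' ≫ Groupoid.inv (c w))
    simp [conj]
  have conj_id : ∀ v, conj v v (𝟙 _) = 1 := fun v => by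
    change c v ≫ 𝟙 _ ≫ Groupoid.inv (c v) = 𝟙 _
    simp
  -- The default `1` is harmless: neither the cocycle identity at scale `q` nor the agreement with
  -- `φ` involves pairs at distance at least `q`.
  let g : X → X → G := fun x y =>
    open Classical in if hxy : dist x y < q then conj x y (ripsEdge hxy) else 1
  have hg : IsRipsCocycle (q : ℝ) g := by
    intro x y z hxy hyz hxz
    simp only [g, dif_pos hxy, dif_pos hyz, dif_pos hxz]
    rw [← conj_comp, ripsEdge_comp]
  obtain ⟨φ, hφ, hφg⟩ := hext G g hg
  have hφ' : IsCocycle (openRips X p) φ := fun σ hσ u hu v hv w hw =>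
    hφ u v w (dist_lt_of_mem_openRips hσ hu hv) (dist_lt_of_mem_openRips hσ hv hw)
      (dist_lt_of_mem_openRips hσ hu hw)
  obtain ⟨M, M_id, M_comp, M_edge⟩ := hφ'.exists_monodromy
  have key : ∀ (v w : X) (f : vertexObj (openRips X q) v ⟶ vertexObj (openRips X q) w) (a : G),
      M v w ((FundamentalGroupoid.map (inclusion (openRips_mono X h))).map f) a =
        conj v w f * a := by
    intro v w f a
    induction isEdgePath f with
    | nil =>
      rw [conj_id, one_mul]
      exact (congrArg (fun x => M v v x a) (CategoryTheory.Functor.map_id _ _)).trans (M_id v a)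
    | @snoc w z f hf σ hσ hw hz ih =>
      have hd := dist_lt_of_mem_openRips hσ hw hz
      have e : φ w z = conj w z (edgeHom hσ hw hz) := by
        rw [hφg _ _ hd, edgeHom_eq_ripsEdge]
        exact dif_pos hd
      rw [Functor.map_comp, map_edgeHom, conj_comp, mul_assoc, ← ih, ← e]
      exact (M_comp _ _ _ _ _ _).trans (M_edge _ _ _ _ _ _ _)
  -- The image of `f` is trivial, so its monodromy fixes `1`; hence the conjugate of `f` by `c x₀`
  -- is trivial.
  have h1 := key x₀ x₀ f 1
  rw [hf, M_id, mul_one] at h1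
  have h2 : 𝟙 _ = c x₀ ≫ f ≫ Groupoid.inv (c x₀) := h1
  have h3 : c x₀ ≫ 𝟙 _ = c x₀ ≫ f := by
    simpa using congrArg (· ≫ c x₀) h2
  exact ((cancel_epi (c x₀)).1 h3).symm

/-- On a compact geodesic space the bonding maps into scale `p` are isomorphisms for all scales
`q < p` close enough to `p`. -/
theorem IsGeodesicSpace.exists_isIso_map [CompactSpace X] (hX : IsGeodesicSpace X) (x₀ : X)
    (p : Set.Ioi (0 : ℝ)) : ∃ ε₀ : ℝ, 0 < ε₀ ∧
      ∀ (q : Set.Ioi (0 : ℝ)) (h : q < p), (p : ℝ) - ε₀ < q →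
        IsIso ((openRipsPiOne X x₀).map (homOfLE h.le)) := by
  have hp : (0 : ℝ) < p := p.2
  have h23 : (2 / 3 : ℝ) * p < p := by linarith
  have hev := (hX.eventually_exists_extension hp).and (Ioo_mem_nhdsLT h23)
  obtain ⟨l, hl, hlp⟩ := (mem_nhdsLT_iff_exists_Ioo_subset' h23).1 hev
  refine ⟨p - l, sub_pos.2 hl, fun q hqp hq => ?_⟩
  have hlq : l < q := by linarith
  obtain ⟨hext, hq23, -⟩ := hlp ⟨hlq, hqp⟩
  rw [ConcreteCategory.isIso_iff_bijective]
  constructor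
  · change Function.Injective (FundamentalGroup.map (inclusion (openRips_mono X hqp.le))
      (vertex (openRips X q) x₀))
    refine (injective_iff_map_eq_one _).2 fun f hf => ?_
    exact hX.eq_one_of_map_eq_one hqp.le hext x₀ f hf
  · exact fun f => hX.exists_map_eq hqp.le hq23 f

end Rips

theorem mainTheorem12 (X : Type u) [MetricSpace X] [CompactSpace X] (hX : IsGeodesicSpace X)
    (x₀ : X) :
    (∀ p : Set.Ioi (0 : ℝ), IsCriticalValue (openRipsPiOne X x₀) p →
      IsRightCriticalValue (openRipsPiOne X x₀) p) ∧
    (∀ p : Set.Ioi (0 : ℝ), ¬ IsLeftCriticalValue (openRipsPiOne X x₀) p) ∧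
    (∀ p : Set.Ioi (0 : ℝ), ∃ ε₀ : ℝ, 0 < ε₀ ∧
      ∀ (q : Set.Ioi (0 : ℝ)) (h : q < p), (p : ℝ) - ε₀ < q →
        IsIso ((openRipsPiOne X x₀).map (homOfLE h.le))) := by
  have hleft : ∀ p : Set.Ioi (0 : ℝ), ¬ IsLeftCriticalValue (openRipsPiOne X x₀) p := by
    rintro p ⟨ε₁, hε₁, h1⟩
    obtain ⟨ε₂, hε₂, h2⟩ := hX.exists_isIso_map x₀ p
    have hp : (0 : ℝ) < p := p.2
    -- A positive scale below `p` that lies within both `ε₁` and `ε₂` of it.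
    obtain ⟨q, hq, hqp⟩ := exists_between
      (max_lt hp (max_lt (sub_lt_self (p : ℝ) hε₁) (sub_lt_self (p : ℝ) hε₂)))
    simp only [max_lt_iff] at hq
    exact h1 ⟨q, hq.1⟩ hqp hq.2.1 (h2 ⟨q, hq.1⟩ hqp hq.2.2)
  exact ⟨fun p hp => hp.resolve_left (hleft p), hleft, hX.exists_isIso_map x₀⟩
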